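/- **Setting.** Let $n,m\ge 0$ be integers. Points of $\mathbb R^{1+n}\times\mathbb R^m$ are written $(x,y)$ with $x=(x^0,\dots,x^n)$ (space-time, $x^0=t$) and $y=(y^1,\dots,y^m)$ (fields). Let $Y\subseteq\mathbb R^{1+n}\times\mathbb R^m$ be open and let $F^\mu_i,\Pi_i\in C^\infty(Y)$ $(0\le\mu\le n,\ 1\le i\le m)$ be the constitutive functions of a balance system $$\textstyle\sum_\mu \partial_\mu\big(F^\mu_i(x,y(x))\big)=\Pi_i(x,y(x)),\qquad i=1,\dots,m,\qquad(\bigstar)$$ whose densities are the fields themselves: $F^0_i=y^i$. Solutions are smooth local sections $y=s(x)$ over open subsets of $\mathbb R^{1+n}$ with graph in $Y$. A *supplementary balance law* over an open $W\subseteq Y$ is a balance law $\sum_\mu\partial_\mu(K^\mu(x,y(x)))=Q(x,y(x))$ with $K^\mu,Q\in C^\infty(W)$ that holds for every solution of $(\bigstar)$ with graph in $W$. Its *main fields* (Lagrange multipliers) are functions $\lambda^i\in C^\infty(W)$ with $$\textstyle\sum_i\lambda^iF^\mu_{i,y^j}=K^\mu_{,y^j}\ \ (\text{all }\mu,j),\qquad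 \sum_i\lambda^i\big(\Pi_i-\sum_\mu F^\mu_{i,x^\mu}\big)=Q-\sum_\mu K^\mu_{,x^\mu}.$$ They are *functionally independent* if their vertical differentials $d_v\lambda^i=\sum_j\lambda^i_{,y^j}dy^j$ are linearly independent at each point of $W$. A function $h^0$ *generates a supplementary balance law with functionally independent main fields near* $(x_0,y_0)$ if, on some open neighbourhood $W\subseteq Y$ of this point, there is a supplementary balance law with density $K^0=h^0$ which has functionally independent main fields. For $1\le A\le n$ put $\eta^A_k=\sum_iF^A_{i,y^k}\,\partial_{y^i}$. Let $E$ be the ring of smooth functions on $Y$, and let $\mathcal M_C$ be the cyclic module over the vertical differential operators with coefficients in $E$ defined by the operators $\eta^A_k\partial_{y^j}-\eta^A_j\partial_{y^k}$. Its *characteristic variety* is understood here as the set of points of the vertical cotangent bundle $V^*(Y)=Y\times(\mathbb R^m)^*$ in the support of the $E[\zeta_1,\dots,\zeta_m]$-module $E[\zeta]/I$, where $I$ is generated by the principal symbols of these operators, $$\textstyle\eta^A_k(\zeta)\zeta_j-\eta^A_j(\zeta)\zeta_k,\qquad \eta^A_k(\zeta)=\sum_iF^A_{i,y^k}\zeta_i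 .$$ **Theorem 5.** 1. Assume that $(\bigstar)$ is nondegenerate, i.e. that each 1-jet $(x,y,z)$, $(x,y)\in Y$, which satisfies its equations is the 1-jet of a smooth local solution (the maximal rank condition is automatic since $F^0_i=y^i$). Then every supplementary balance law over an open set $W\subseteq Y$ has unique main fields, namely $\lambda^i=\partial K^0/\partial y^i$. Moreover, let $(x_0,y_0)\in Y$ and let $h^0=h^0(x,y)$ be a smooth function on an open neighbourhood of $(x_0,y_0)$ in $Y$. Then $h^0$ generates a supplementary balance law with functionally independent main fields near $(x_0,y_0)$ if and only if, in a neighbourhood of $(x_0,y_0)$, $$(\eta^A_k\partial_{y^j}-\eta^A_j\partial_{y^k})h^0=0\qquad(k\ne j,\ A=1,\dots,n)$$ and the vertical Hessian $\big(\partial^2h^0/\partial y^i\partial y^j\big)$ is nondegenerate. 2. The characteristic variety of $\mathcal M_C$ is the union of the zero section of $V^*(Y)\to Y$ and of the lines spanned by the common (real) eigenvectors of the operators $L^A(x,y):V^*_{(x,y)}(Y)\to V^*_{(x,y)}(Y)$, $A=1,\dots,n$, $(L^A\zeta)_j=\sum_kF^A_{k,y^j}\zeta_k$. -/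

import Mathlib

open scoped ContDiff

noncomputable section

/-- Points `(x, y)` of the configurational bundle: `x = (x⁰, x¹, …, xⁿ)` is a space-time point
(`x⁰ = t`), `y = (y¹, …, yᵐ)` are the fields. -/
abbrev Conf (n m : ℕ) : Type := (Fin (n + 1) → ℝ) × (Fin m → ℝ)

variable {n m : ℕ}

/-- `∂f/∂x^μ`, the explicit partial derivative with respect to the base variable `x^μ`. -/
def baseDeriv (μ : Fin (n + 1)) (f : Conf n m → ℝ) (p : Conf n m) : ℝ :=
  fderiv ℝ f p (Pi.single μ 1, 0)

/-- `∂f/∂y^j`, the partial derivative with respect to the vertical variable `y^j`. -/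
def vertDeriv (j : Fin m) (f : Conf n m → ℝ) (p : Conf n m) : ℝ :=
  fderiv ℝ f p (0, Pi.single j 1)

/-- The vertical differential `d_v f` at `p`, a covector on the fibre. -/
def vertDiff (f : Conf n m → ℝ) (p : Conf n m) : (Fin m → ℝ) →L[ℝ] ℝ :=
  (fderiv ℝ f p).comp (ContinuousLinearMap.inr ℝ (Fin (n + 1) → ℝ) (Fin m → ℝ))

/-- The vertical Hessian `∂²h/∂y^i∂y^j` at `p`. -/
def vertHessian (h : Conf n m → ℝ) (p : Conf n m) : Matrix (Fin m) (Fin m) ℝ :=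
  Matrix.of fun i j => vertDeriv i (vertDeriv j h) p

lemma contDiffOn_vertDeriv {Y : Set (Conf n m)} (hY : IsOpen Y) {f : Conf n m → ℝ}
    (hf : ContDiffOn ℝ ∞ f Y) (j : Fin m) : ContDiffOn ℝ ∞ (vertDeriv j f) Y :=
  (hf.fderiv_of_isOpen hY (m := ∞) (by simp)).clm_apply contDiffOn_const

/-- `∑_μ ∂/∂x^μ (G^μ(x, s(x)))`, the space-time divergence of a current `G^μ(x, y)` along a section
`x ↦ (x, s x)`. -/
def sectionDiv (G : Fin (n + 1) → Conf n m → ℝ) (s : (Fin (n + 1) → ℝ) → (Fin m → ℝ))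
    (x : Fin (n + 1) → ℝ) : ℝ :=
  ∑ μ, fderiv ℝ (fun x' => G μ (x', s x')) x (Pi.single μ 1)

/-- A (smooth) local section over an open set `D` of the base, with graph in `W`. -/
structure IsLocalSection (W : Set (Conf n m)) (D : Set (Fin (n + 1) → ℝ))
    (s : (Fin (n + 1) → ℝ) → (Fin m → ℝ)) : Prop where
  isOpen : IsOpen D
  smooth : ContDiffOn ℝ ∞ s D
  mem : ∀ x ∈ D, (x, s x) ∈ W

/-- A balance system of order zero (RET type) `∑_μ ∂_μ (F^μ_i(x, y(x))) = Π_i(x, y(x))`,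
`i = 1, …, m`, whose constitutive functions are smooth on the open set `Y`.
`F 0 i` are the densities and `F A.succ i` the fluxes. -/
structure BalanceSystem (n m : ℕ) where
  /-- the domain of the constitutive functions -/
  Y : Set (Conf n m)
  isOpen : IsOpen Y
  /-- densities (index `0`) and fluxes (indices `A.succ`) -/
  F : Fin (n + 1) → Fin m → Conf n m → ℝ
  /-- production and source terms -/
  Prod : Fin m → Conf n m → ℝ
  smooth_F : ∀ μ i, ContDiffOn ℝ ∞ (F μ i) Y
  smooth_Prod : ∀ i, ContDiffOn ℝ ∞ (Prod i) Y

namespace BalanceSystem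

/-- `s` is a solution over `D`, with graph in `W`, of the balance system. -/
def IsSolution (B : BalanceSystem n m) (W : Set (Conf n m)) (D : Set (Fin (n + 1) → ℝ))
    (s : (Fin (n + 1) → ℝ) → (Fin m → ℝ)) : Prop :=
  IsLocalSection W D s ∧ ∀ x ∈ D, ∀ i, sectionDiv (fun μ => B.F μ i) s x = B.Prod i (x, s x)

/-- The 1-jet `(x, y, z)`, `p = (x, y)`, `z j μ = z^j_μ`, satisfies the equations of the system. -/
def JetSatisfies (B : BalanceSystem n m) (p : Conf n m) (z : Fin m → Fin (n + 1) → ℝ) : Prop :=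
  ∀ i, ∑ μ, (baseDeriv μ (B.F μ i) p + ∑ j, vertDeriv j (B.F μ i) p * z j μ) = B.Prod i p

/-- Local solvability: every 1-jet over `Y` satisfying the equations is the 1-jet of a smooth
local solution. -/
def IsLocallySolvable (B : BalanceSystem n m) : Prop :=
  ∀ p ∈ B.Y, ∀ z : Fin m → Fin (n + 1) → ℝ, B.JetSatisfies p z →
    ∃ D s, B.IsSolution B.Y D s ∧ p.1 ∈ D ∧ s p.1 = p.2 ∧
      ∀ j μ, fderiv ℝ s p.1 (Pi.single μ 1) j = z j μ

/-- The balance law `∑_μ ∂_μ (K^μ(x, y(x))) = Q(x, y(x))`, smooth on the open set `W ⊆ Y`, is a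
supplementary balance law over `W`: every solution with graph in `W` satisfies it. -/
structure IsSupplementary (B : BalanceSystem n m) (W : Set (Conf n m))
    (K : Fin (n + 1) → Conf n m → ℝ) (Q : Conf n m → ℝ) : Prop where
  isOpen : IsOpen W
  subset : W ⊆ B.Y
  smooth_K : ∀ μ, ContDiffOn ℝ ∞ (K μ) W
  smooth_Q : ContDiffOn ℝ ∞ Q W
  holds : ∀ D s, B.IsSolution W D s → ∀ x ∈ D, sectionDiv K s x = Q (x, s x)

/-- `lam` are main fields (Lagrange multipliers) over `W` of the balance law `(K, Q)`: smooth
functions solving the Lagrange-Liu system. -/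
structure IsMainFields (B : BalanceSystem n m) (W : Set (Conf n m))
    (K : Fin (n + 1) → Conf n m → ℝ) (Q : Conf n m → ℝ) (lam : Fin m → Conf n m → ℝ) :
    Prop where
  smooth : ∀ i, ContDiffOn ℝ ∞ (lam i) W
  vert : ∀ p ∈ W, ∀ μ j, ∑ i, lam i p * vertDeriv j (B.F μ i) p = vertDeriv j (K μ) p
  source : ∀ p ∈ W, ∑ i, lam i p * (B.Prod i p - ∑ μ, baseDeriv μ (B.F μ i) p) =
    Q p - ∑ μ, baseDeriv μ (K μ) p

/-- The functions `lam i` are functionally independent along the fibres over `W`: their vertical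
differentials are linearly independent at every point of `W`. -/
def _root_.FunctionallyIndependentOn (W : Set (Conf n m)) (lam : Fin m → Conf n m → ℝ) : Prop :=
  ∀ p ∈ W, LinearIndependent ℝ fun i => vertDiff (lam i) p

/-- In a neighbourhood of `p₀`, the function `h` is the density of a supplementary balance law
with functionally independent main fields. -/
def GeneratesSupplementaryNear (B : BalanceSystem n m) (p₀ : Conf n m) (h : Conf n m → ℝ) :
    Prop :=
  ∃ (W : Set (Conf n m)) (K : Fin (n + 1) → Conf n m → ℝ) (Q : Conf n m → ℝ)
    (lam : Fin m → Conf n m → ℝ), p₀ ∈ W ∧ B.IsSupplementary W K Q ∧ (∀ p ∈ W, K 0 p = h p) ∧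
      B.IsMainFields W K Q lam ∧ FunctionallyIndependentOn W lam

/-- The `i`-th component `F^A_{i,y^k}` of the vertical vector field
`η^A_k = ∑_i F^A_{i,y^k} ∂_{y^i}`. -/
def eta (B : BalanceSystem n m) (A : Fin n) (k i : Fin m) : Conf n m → ℝ :=
  vertDeriv k (B.F A.succ i)

/-- The action of the vector field `η^A_k` on functions. -/
def etaApply (B : BalanceSystem n m) (A : Fin n) (k : Fin m) (f : Conf n m → ℝ)
    (p : Conf n m) : ℝ :=
  ∑ i, B.eta A k i p * vertDeriv i f p

/-- The operator `η^A_k ∂_{y^j} - η^A_j ∂_{y^k}`. These operators generate the left ideal that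
defines the cyclic D-module `M_C`. -/
def defOp (B : BalanceSystem n m) (A : Fin n) (j k : Fin m) (h : Conf n m → ℝ)
    (p : Conf n m) : ℝ :=
  B.etaApply A k (vertDeriv j h) p - B.etaApply A j (vertDeriv k h) p

/-- The ring `E` of smooth functions on `Y`. -/
def SmoothRing (B : BalanceSystem n m) : Subring (B.Y → ℝ) where
  carrier := {f | ∃ g : Conf n m → ℝ, ContDiffOn ℝ ∞ g B.Y ∧ ∀ p : B.Y, f p = g p}
  mul_mem' := by
    rintro _ _ ⟨g, hg, e⟩ ⟨g', hg', e'⟩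
    exact ⟨fun p => g p * g' p, hg.mul hg', fun p => by simp [e, e']⟩
  one_mem' := ⟨fun _ => 1, contDiffOn_const, fun _ => rfl⟩
  add_mem' := by
    rintro _ _ ⟨g, hg, e⟩ ⟨g', hg', e'⟩
    exact ⟨fun p => g p + g' p, hg.add hg', fun p => by simp [e, e']⟩
  zero_mem' := ⟨fun _ => 0, contDiffOn_const, fun _ => rfl⟩
  neg_mem' := by
    rintro _ ⟨g, hg, e⟩
    exact ⟨fun p => - g p, hg.neg, fun p => by simp [e]⟩

/-- `F^A_{i,y^k}` as an element of `E`. -/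
def etaCoeff (B : BalanceSystem n m) (A : Fin n) (k i : Fin m) : B.SmoothRing :=
  ⟨fun p => B.eta A k i p, B.eta A k i,
    contDiffOn_vertDeriv B.isOpen (B.smooth_F A.succ i) k, fun _ => rfl⟩

/-- The symbol `η^A_k(ζ) = ∑_i F^A_{i,y^k} ζ_i` of the vector field `η^A_k`, in `E[ζ]`. -/
def etaSymbol (B : BalanceSystem n m) (A : Fin n) (k : Fin m) :
    MvPolynomial (Fin m) B.SmoothRing :=
  ∑ i, MvPolynomial.C (B.etaCoeff A k i) * MvPolynomial.X i

/-- The principal symbol `η^A_k(ζ) ζ_j - η^A_j(ζ) ζ_k` of the operator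
`η^A_k ∂_{y^j} - η^A_j ∂_{y^k}`. -/
def opSymbol (B : BalanceSystem n m) (A : Fin n) (j k : Fin m) :
    MvPolynomial (Fin m) B.SmoothRing :=
  B.etaSymbol A k * MvPolynomial.X j - B.etaSymbol A j * MvPolynomial.X k

/-- The ideal of `E[ζ]` generated by the principal symbols of the operators defining `M_C`. -/
def symbolIdeal (B : BalanceSystem n m) : Ideal (MvPolynomial (Fin m) B.SmoothRing) :=
  Ideal.span {P | ∃ A j k, j ≠ k ∧ P = B.opSymbol A j k}

/-- Evaluation `E[ζ] → ℝ` of a polynomial symbol at the vertical covector `(p, ∑_j ζ_j dy^j)`. -/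
def evalAt (B : BalanceSystem n m) (p : B.Y) (ζ : Fin m → ℝ) :
    MvPolynomial (Fin m) B.SmoothRing →+* ℝ :=
  MvPolynomial.eval₂Hom ((Pi.evalRingHom (fun _ : B.Y => ℝ) p).comp B.SmoothRing.subtype) ζ

/-- The point of `Spec E[ζ]` given by the vertical covector `(p, ∑_j ζ_j dy^j)`. -/
def covectorPoint (B : BalanceSystem n m) (p : B.Y) (ζ : Fin m → ℝ) :
    PrimeSpectrum (MvPolynomial (Fin m) B.SmoothRing) :=
  ⟨RingHom.ker (B.evalAt p ζ), RingHom.ker_isPrime _⟩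

/-- The (relative) characteristic variety: the support, in the vertical cotangent bundle
`V*(Y) = Y × ℝᵐ` (fibre coordinates `ζ_j` with respect to `dy^j`), of the `E[ζ]`-module `E[ζ]/I`,
`I` being generated by the principal symbols of the defining operators. -/
def charVariety (B : BalanceSystem n m) : Set (B.Y × (Fin m → ℝ)) :=
  {q | B.covectorPoint q.1 q.2 ∈ Module.support (MvPolynomial (Fin m) B.SmoothRing)
    (MvPolynomial (Fin m) B.SmoothRing ⧸ B.symbolIdeal)}

/-- The operator `L^A(p)` on vertical covectors, `(L^A ζ)_j = ∑_k F^A_{k,y^j} ζ_k`. -/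
def covectorOp (B : BalanceSystem n m) (A : Fin n) (p : Conf n m) :
    Module.End ℝ (Fin m → ℝ) :=
  Matrix.mulVecLin (Matrix.of fun j k => vertDeriv j (B.F A.succ k) p)

/-- `v` is a common (real) eigenvector of the operators `L^A(p)`, `A = 1, …, n`. -/
def IsCommonEigenvector (B : BalanceSystem n m) (p : Conf n m) (v : Fin m → ℝ) : Prop :=
  v ≠ 0 ∧ ∀ A, ∃ μ : ℝ, (B.covectorOp A p).HasEigenvector μ v

end BalanceSystem

end

section

variable {n m : ℕ}

/-! Since F⁰_i = yⁱ, the μ = 0 main field equations read λʲ = ∂K⁰/∂yʲ, which gives uniqueness. For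
existence, the same normalization lets each equation be solved for a time derivative, so the spatial
derivatives of the fields are free in a jet satisfying the system. Local solvability turns the
supplementary law into an identity affine in these free variables, and its coefficients are the
remaining main field equations (`IsSupplementary.isMainFields`).

With λⁱ = ∂h⁰/∂yⁱ, a flux K^A exists locally iff the vertical form ∑ λⁱ d_vF^A_i is closed. The
second derivatives of F cancel in this condition, and what remains is the vanishing of `defOp`
(`defOp_eq`). The fibrewise Poincaré lemma `exists_vertDeriv_eq` makes K^A smooth in x as well, and
Q is then defined by the source equation. Independence of the λⁱ is invertibility of the Hessian.

The support of E[ζ]/I is the zero locus of I. At (p, ζ) the generators become, up to sign, the 2×2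
minors of the pairs (L^A ζ, ζ), which all vanish iff ζ is zero or a common eigenvector. -/

/-! ### Smoothness of integrals depending on parameters. -/

open Set MeasureTheory in
/-- Differentiation under the integral sign over `[0, 1]`, for a smooth integrand. -/
theorem hasFDerivAt_integral_unitInterval_of_contDiffOn {H E : Type*}
    [NormedAddCommGroup H] [NormedSpace ℝ H] [FiniteDimensional ℝ H]
    [NormedAddCommGroup E] [NormedSpace ℝ E] {Ω : Set (H × ℝ)} (hΩ : IsOpen Ω)
    {f : H × ℝ → E} (hf : ContDiffOn ℝ ∞ f Ω) {x₀ : H} (hx₀ : ∀ t ∈ Icc (0 : ℝ) 1, (x₀, t) ∈ Ω) :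
    HasFDerivAt (fun x => ∫ t in (0 : ℝ)..1, f (x, t))
      (∫ t in (0 : ℝ)..1, (fderiv ℝ f (x₀, t)).comp (ContinuousLinearMap.inl ℝ H ℝ)) x₀ := by
  -- Compactness of [0, 1] gives a compact tube inside `Ω`, on which the derivative has the uniform
  -- bound `C` needed for domination.
  obtain ⟨u, v, hu, -, hxu, hIv, huv⟩ := generalized_tube_lemma (s := {x₀}) isCompact_singleton
    (t := Icc (0 : ℝ) 1) isCompact_Icc hΩ (by rintro ⟨x, t⟩ ⟨rfl, ht⟩; exact hx₀ t ht)
  obtain ⟨r, hr, hru⟩ := Metric.nhds_basis_closedBall.mem_iff.1 (hu.mem_nhds (hxu rfl))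
  have hsub : Metric.closedBall x₀ r ×ˢ Icc (0 : ℝ) 1 ⊆ Ω :=
    (prod_mono hru hIv).trans huv
  have hsub' : ∀ x ∈ Metric.closedBall x₀ r, ∀ t ∈ Icc (0 : ℝ) 1, (x, t) ∈ Ω :=
    fun x hx t ht => hsub ⟨hx, ht⟩
  have hd : ContinuousOn (fun q => (fderiv ℝ f q).comp (ContinuousLinearMap.inl ℝ H ℝ)) Ω :=
    (hf.continuousOn_fderiv_of_isOpen hΩ (by simp)).clm_comp continuousOn_const
  have : ProperSpace H := FiniteDimensional.proper ℝ H
  obtain ⟨C, hC⟩ := ((isCompact_closedBall x₀ r).prod isCompact_Icc).exists_bound_of_continuousOn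
    (hd.mono hsub)
  have hI : uIoc (0 : ℝ) 1 ⊆ Icc 0 1 := by
    rw [uIoc_of_le zero_le_one]; exact Ioc_subset_Icc_self
  have hslice : ∀ x ∈ Metric.closedBall x₀ r, ContinuousOn (fun t : ℝ => f (x, t)) (Icc 0 1) :=
    fun x hx => hf.continuousOn.comp (by fun_prop) (hsub' x hx)
  have hx₀r := Metric.mem_closedBall_self (x := x₀) hr.le
  refine (intervalIntegral.hasFDerivAt_integral_of_dominated_of_fderiv_le (μ := volume)
    (s := Metric.closedBall x₀ r) (bound := fun _ => C)
    (F := fun x t => f (x, t))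
    (F' := fun x t => (fderiv ℝ f (x, t)).comp (ContinuousLinearMap.inl ℝ H ℝ))
    (Metric.closedBall_mem_nhds x₀ hr) ?_ ?_ ?_ ?_ ?_ ?_)
  · filter_upwards [Metric.closedBall_mem_nhds x₀ hr] with x hx
    exact ((hslice x hx).mono hI).aestronglyMeasurable measurableSet_uIoc
  · refine ContinuousOn.intervalIntegrable ?_
    rw [uIcc_of_le zero_le_one]
    exact hslice x₀ hx₀r
  · exact ((hd.comp (by fun_prop) (hsub' x₀ hx₀r)).mono hI).aestronglyMeasurable measurableSet_uIoc
  · exact Filter.Eventually.of_forall fun t ht x hx => hC (x, t) ⟨hx, hI ht⟩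
  · exact intervalIntegrable_const
  · refine Filter.Eventually.of_forall fun t ht x hx => ?_
    have h1 : HasFDerivAt f (fderiv ℝ f (x, t)) (x, t) :=
      ((hf.contDiffAt (hΩ.mem_nhds (hsub' x hx t (hI ht)))).differentiableAt (by simp)).hasFDerivAt
    exact h1.comp x (hasFDerivAt_prodMk_left x t)

open Set in
/-- An integral over `[0, 1]` depending smoothly on parameters is smooth. -/
theorem contDiffOn_integral_unitInterval {H E : Type}
    [NormedAddCommGroup H] [NormedSpace ℝ H] [FiniteDimensional ℝ H]
    [NormedAddCommGroup E] [NormedSpace ℝ E] {Ω : Set (H × ℝ)} (hΩ : IsOpen Ω)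
    {f : H × ℝ → E} (hf : ContDiffOn ℝ ∞ f Ω) {U : Set H} (hU : IsOpen U)
    (hUΩ : ∀ x ∈ U, ∀ t ∈ Icc (0 : ℝ) 1, (x, t) ∈ Ω) :
    ContDiffOn ℝ ∞ (fun x => ∫ t in (0 : ℝ)..1, f (x, t)) U := by
  rw [contDiffOn_infty]
  intro k
  -- The derivative is an integral of the same kind with values in `H →L[ℝ] E`; with `H` and `E` in
  -- `Type`, this space stays in the universe of `E`.
  induction k generalizing E with
  | zero =>
    exact contDiffOn_zero.2 fun x hx => (hasFDerivAt_integral_unitInterval_of_contDiffOn hΩ hf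
      (hUΩ x hx)).continuousAt.continuousWithinAt
  | succ k ih =>
    push_cast
    rw [contDiffOn_succ_iff_fderiv_of_isOpen hU]
    refine ⟨fun x hx => (hasFDerivAt_integral_unitInterval_of_contDiffOn hΩ hf
      (hUΩ x hx)).differentiableAt.differentiableWithinAt, by simp, ?_⟩
    refine (ih (f := fun q => (fderiv ℝ f q).comp (ContinuousLinearMap.inl ℝ H ℝ)) ?_).congr
      fun x hx => (hasFDerivAt_integral_unitInterval_of_contDiffOn hΩ hf (hUΩ x hx)).fderiv
    exact (hf.fderiv_of_isOpen hΩ (m := ∞) (by simp)).clm_comp contDiffOn_const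

/-! ### Calculus of base and vertical derivatives. -/

lemma vertDeriv_congr {W : Set (Conf n m)} (hW : IsOpen W) {f g : Conf n m → ℝ}
    (h : ∀ p ∈ W, f p = g p) (j : Fin m) {p : Conf n m} (hp : p ∈ W) :
    vertDeriv j f p = vertDeriv j g p := by
  have : f =ᶠ[nhds p] g := Filter.eventually_of_mem (hW.mem_nhds hp) h
  rw [vertDeriv, vertDeriv, this.fderiv_eq]

lemma baseDeriv_congr {W : Set (Conf n m)} (hW : IsOpen W) {f g : Conf n m → ℝ}
    (h : ∀ p ∈ W, f p = g p) (μ : Fin (n + 1)) {p : Conf n m} (hp : p ∈ W) :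
    baseDeriv μ f p = baseDeriv μ g p := by
  have : f =ᶠ[nhds p] g := Filter.eventually_of_mem (hW.mem_nhds hp) h
  rw [baseDeriv, baseDeriv, this.fderiv_eq]

lemma contDiffOn_baseDeriv {W : Set (Conf n m)} (hW : IsOpen W) {f : Conf n m → ℝ}
    (hf : ContDiffOn ℝ ∞ f W) (μ : Fin (n + 1)) : ContDiffOn ℝ ∞ (baseDeriv μ f) W :=
  (hf.fderiv_of_isOpen hW (m := ∞) (by simp)).clm_apply contDiffOn_const

lemma ContDiffOn.hasFDerivAt_of_isOpen {W : Set (Conf n m)} (hW : IsOpen W) {f : Conf n m → ℝ}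
    (hf : ContDiffOn ℝ ∞ f W) {p : Conf n m} (hp : p ∈ W) : HasFDerivAt f (fderiv ℝ f p) p :=
  ((hf.contDiffAt (hW.mem_nhds hp)).differentiableAt (by simp)).hasFDerivAt

lemma vertDeriv_comm {W : Set (Conf n m)} (hW : IsOpen W) {f : Conf n m → ℝ}
    (hf : ContDiffOn ℝ ∞ f W) (i j : Fin m) {p : Conf n m} (hp : p ∈ W) :
    vertDeriv i (vertDeriv j f) p = vertDeriv j (vertDeriv i f) p := by
  have hd : DifferentiableAt ℝ (fderiv ℝ f) p :=
    (((hf.fderiv_of_isOpen hW (m := ∞) (by simp)).contDiffAt (hW.mem_nhds hp))).differentiableAt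
      (by simp)
  have hs : IsSymmSndFDerivAt ℝ f p :=
    (hf.contDiffAt (hW.mem_nhds hp)).isSymmSndFDerivAt
      (by simpa using WithTop.coe_le_coe.2 (le_top : (2 : ℕ∞) ≤ ⊤))
  have key : ∀ i j : Fin m, vertDeriv i (vertDeriv j f) p =
      fderiv ℝ (fderiv ℝ f) p (0, Pi.single i 1) (0, Pi.single j 1) := by
    intro i j
    have h := hd.hasFDerivAt.clm_apply
      (hasFDerivAt_const ((0, Pi.single j 1) : Conf n m) p)
    simp only [vertDeriv]
    erw [h.fderiv]
    simp
  rw [key, key, hs.eq]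

lemma vertDeriv_sum_mul {W : Set (Conf n m)} (hW : IsOpen W) {a b : Fin m → Conf n m → ℝ}
    (ha : ∀ i, ContDiffOn ℝ ∞ (a i) W) (hb : ∀ i, ContDiffOn ℝ ∞ (b i) W) (k : Fin m)
    {p : Conf n m} (hp : p ∈ W) :
    vertDeriv k (fun q => ∑ i, a i q * b i q) p =
      ∑ i, (a i p * vertDeriv k (b i) p + vertDeriv k (a i) p * b i p) := by
  have h := HasFDerivAt.fun_sum (u := Finset.univ) fun i _ =>
    ((ha i).hasFDerivAt_of_isOpen hW hp).fun_mul ((hb i).hasFDerivAt_of_isOpen hW hp)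
  rw [vertDeriv, HasFDerivAt.fderiv h]
  simp [vertDeriv, mul_comm]

lemma vertDeriv_snd_apply (i j : Fin m) (p : Conf n m) :
    vertDeriv j (fun q : Conf n m => q.2 i) p = (Pi.single j 1 : Fin m → ℝ) i := by
  have h : HasFDerivAt (fun q : Conf n m => q.2 i) ((ContinuousLinearMap.proj i).comp
    (ContinuousLinearMap.snd ℝ (Fin (n + 1) → ℝ) (Fin m → ℝ))) p :=
    ((ContinuousLinearMap.proj i).comp
      (ContinuousLinearMap.snd ℝ (Fin (n + 1) → ℝ) (Fin m → ℝ))).hasFDerivAt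
  rw [vertDeriv, h.fderiv]; simp

lemma baseDeriv_snd_apply (i : Fin m) (μ : Fin (n + 1)) (p : Conf n m) :
    baseDeriv μ (fun q : Conf n m => q.2 i) p = 0 := by
  have h : HasFDerivAt (fun q : Conf n m => q.2 i) ((ContinuousLinearMap.proj i).comp
    (ContinuousLinearMap.snd ℝ (Fin (n + 1) → ℝ) (Fin m → ℝ))) p :=
    ((ContinuousLinearMap.proj i).comp
      (ContinuousLinearMap.snd ℝ (Fin (n + 1) → ℝ) (Fin m → ℝ))).hasFDerivAt
  rw [baseDeriv, h.fderiv]; simp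

lemma fderiv_apply_vertical (f : Conf n m → ℝ) (p : Conf n m) (v : Fin m → ℝ) :
    fderiv ℝ f p (0, v) = ∑ j, vertDeriv j f p * v j := by
  have : ((0, v) : Conf n m) = ∑ j, v j • ((0, Pi.single j 1) : Conf n m) := by
    ext i
    · simp [Prod.fst_sum]
    · simp [Prod.snd_sum, Finset.sum_apply, Pi.single_apply]
  rw [this, map_sum]
  simp only [map_smul, smul_eq_mul, vertDeriv, mul_comm]

/-! ### The fibrewise Poincaré lemma. -/

open Set in
/-- The Poincaré lemma along the fibres: a vertical `1`-form which is closed along the fibres of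
`U × ball y₀ r` has a primitive there which is smooth in all variables. -/
theorem exists_vertDeriv_eq {U : Set (Fin (n + 1) → ℝ)} (hU : IsOpen U) {y₀ : Fin m → ℝ} {r : ℝ}
    (hr : 0 < r) {g : Fin m → Conf n m → ℝ}
    (hg : ∀ j, ContDiffOn ℝ ∞ (g j) (U ×ˢ Metric.ball y₀ r))
    (hclosed : ∀ p ∈ U ×ˢ Metric.ball y₀ r, ∀ j k,
      vertDeriv k (g j) p = vertDeriv j (g k) p) :
    ∃ K : Conf n m → ℝ, ContDiffOn ℝ ∞ K (U ×ˢ Metric.ball y₀ r) ∧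
      ∀ p ∈ U ×ˢ Metric.ball y₀ r, ∀ j, vertDeriv j K p = g j p := by
  set V := Metric.ball y₀ r
  have hW : IsOpen (U ×ˢ V) := hU.prod Metric.isOpen_ball
  have hVc : Convex ℝ V := convex_ball y₀ r
  have hy₀ : y₀ ∈ V := Metric.mem_ball_self hr
  let α : (Fin (n + 1) → ℝ) → (Fin m → ℝ) → ((Fin m → ℝ) →L[ℝ] ℝ) := fun x y =>
    ∑ j, g j (x, y) • (ContinuousLinearMap.proj j : (Fin m → ℝ) →L[ℝ] ℝ)
  let K : Conf n m → ℝ := fun p => ∫ᶜ y in Path.segment y₀ p.2, α p.1 y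
  -- The curve integral theorem used below only differentiates in y at fixed x; joint smoothness
  -- comes from writing `K` as an integral over [0, 1].
  have hsmooth : ContDiffOn ℝ ∞ K (U ×ˢ V) := by
    let φ : Conf n m × ℝ → Conf n m := fun q => (q.1.1, AffineMap.lineMap y₀ q.1.2 q.2)
    have hφ : ContDiff ℝ ∞ φ := by
      simp only [φ, AffineMap.lineMap_apply_module]
      fun_prop
    have h := contDiffOn_integral_unitInterval (Ω := φ ⁻¹' (U ×ˢ V)) (hW.preimage hφ.continuous)
      (f := fun q => ∑ j, g j (φ q) * (q.1.2 j - y₀ j)) (ContDiffOn.sum fun j _ =>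
        ((hg j).comp hφ.contDiffOn (mapsTo_preimage _ _)).mul (by fun_prop)) hW
      (fun p hp t ht => ⟨hp.1, hVc.lineMap_mem hy₀ hp.2 ht⟩)
    refine h.congr fun p _ => ?_
    simp only [K, curveIntegral_segment, α, φ]
    simp
  refine ⟨K, hsmooth, fun p hp j => ?_⟩
  obtain ⟨x, y⟩ := p
  have hder : ∀ y ∈ V, HasFDerivAt (α x) (∑ j, ((fderiv ℝ (g j) (x, y)).comp
      (ContinuousLinearMap.inr ℝ (Fin (n + 1) → ℝ) (Fin m → ℝ))).smulRight
        (ContinuousLinearMap.proj j : (Fin m → ℝ) →L[ℝ] ℝ)) y := by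
    intro y hy
    refine HasFDerivAt.fun_sum fun j _ => ?_
    have h : HasFDerivAt (fun y => g j (x, y)) ((fderiv ℝ (g j) (x, y)).comp
        (ContinuousLinearMap.inr ℝ (Fin (n + 1) → ℝ) (Fin m → ℝ))) y :=
      ((hg j).hasFDerivAt_of_isOpen hW (p := (x, y)) ⟨hp.1, hy⟩).comp y (hasFDerivAt_prodMk_right x y)
    exact h.smul_const (ContinuousLinearMap.proj j : (Fin m → ℝ) →L[ℝ] ℝ)
  have hprim := hVc.hasFDerivWithinAt_curveIntegral_segment_of_hasFDerivWithinAt_symmetric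
    (fun y hy => (hder y hy).hasFDerivWithinAt) (fun a ha u _ v _ => by
      simp only [sum_apply, ContinuousLinearMap.smulRight_apply,
        smul_apply, ContinuousLinearMap.comp_apply,
        ContinuousLinearMap.inr_apply, fderiv_apply_vertical, ContinuousLinearMap.proj_apply,
        smul_eq_mul, Finset.sum_mul]
      rw [Finset.sum_comm]
      refine Finset.sum_congr rfl fun i _ => Finset.sum_congr rfl fun j _ => ?_
      rw [hclosed (x, a) ⟨hp.1, ha⟩ j i]
      ring) hy₀ hp.2
  have hprim' := hprim.hasFDerivAt (Metric.isOpen_ball.mem_nhds hp.2)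
  have hK := (hsmooth.hasFDerivAt_of_isOpen hW hp).comp y (hasFDerivAt_prodMk_right x y)
  have := congrArg (fun T : (Fin m → ℝ) →L[ℝ] ℝ => T (Pi.single j 1)) (hK.unique hprim')
  simpa [α, vertDeriv, Pi.single_apply] using this

/-! ### Divergences along sections, jets and main fields. -/

lemma fderiv_apply_single_prod (f : Conf n m → ℝ) (p : Conf n m) (μ : Fin (n + 1))
    (v : Fin m → ℝ) :
    fderiv ℝ f p (Pi.single μ 1, v) = baseDeriv μ f p + ∑ j, vertDeriv j f p * v j := by
  rw [← fderiv_apply_vertical, baseDeriv, ← map_add]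
  simp

/-- The chain rule for the divergence of a current along a section. -/
lemma sectionDiv_eq {W : Set (Conf n m)} (hW : IsOpen W) {G : Fin (n + 1) → Conf n m → ℝ}
    (hG : ∀ μ, ContDiffOn ℝ ∞ (G μ) W) {D : Set (Fin (n + 1) → ℝ)}
    {s : (Fin (n + 1) → ℝ) → (Fin m → ℝ)} (hs : IsLocalSection W D s)
    {x : Fin (n + 1) → ℝ} (hx : x ∈ D) :
    sectionDiv G s x = ∑ μ, (baseDeriv μ (G μ) (x, s x) +
      ∑ j, vertDeriv j (G μ) (x, s x) * fderiv ℝ s x (Pi.single μ 1) j) := by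
  refine Finset.sum_congr rfl fun μ _ => ?_
  have h1 : HasFDerivAt s (fderiv ℝ s x) x :=
    ((hs.smooth.contDiffAt (hs.isOpen.mem_nhds hx)).differentiableAt (by simp)).hasFDerivAt
  have h2 : HasFDerivAt (fun x' => G μ (x', s x')) ((fderiv ℝ (G μ) (x, s x)).comp
      ((ContinuousLinearMap.id ℝ _).prod (fderiv ℝ s x))) x :=
    HasFDerivAt.comp (f := fun x' => (x', s x')) x
      ((hG μ).hasFDerivAt_of_isOpen hW (hs.mem x hx)) ((hasFDerivAt_id x).prodMk h1)
  rw [h2.fderiv, ← fderiv_apply_single_prod]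
  rfl

/-- Used to recognize the flux terms of a current as the combination, with multipliers `l`, of those
of the system. -/
lemma sum_sum_mul_mul_comm {ι κ τ : Type*} [Fintype ι] [Fintype κ] [Fintype τ] (l : ι → ℝ)
    (f : κ → τ → ι → ℝ) (w : κ → τ → ℝ) :
    ∑ a, ∑ j, (∑ i, l i * f a j i) * w a j = ∑ i, l i * ∑ a, ∑ j, f a j i * w a j := by
  simp only [Finset.sum_mul, Finset.mul_sum, mul_assoc]
  symm
  rw [Finset.sum_comm]
  exact Finset.sum_congr rfl fun a _ => Finset.sum_comm

namespace BalanceSystem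

variable (B : BalanceSystem n m)

lemma IsSolution.mono {B : BalanceSystem n m} {W W' : Set (Conf n m)} (hW' : IsOpen W')
    {D : Set (Fin (n + 1) → ℝ)} {s : (Fin (n + 1) → ℝ) → (Fin m → ℝ)} (h : B.IsSolution W D s) :
    B.IsSolution W' (D ∩ (fun x => (x, s x)) ⁻¹' W') s := by
  refine ⟨⟨?_, h.1.smooth.mono Set.inter_subset_left, fun x hx => hx.2⟩, fun x hx => h.2 x hx.1⟩
  exact (continuousOn_id.prodMk h.1.smooth.continuousOn).isOpen_inter_preimage h.1.isOpen hW'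

/-- On a locally solvable system a supplementary balance law holds at the level of `1`-jets. -/
lemma IsSupplementary.jet {B : BalanceSystem n m} (hB : B.IsLocallySolvable)
    {W : Set (Conf n m)} {K : Fin (n + 1) → Conf n m → ℝ} {Q : Conf n m → ℝ}
    (h : B.IsSupplementary W K Q) {p : Conf n m} (hp : p ∈ W) {z : Fin m → Fin (n + 1) → ℝ}
    (hz : B.JetSatisfies p z) :
    ∑ μ, (baseDeriv μ (K μ) p + ∑ j, vertDeriv j (K μ) p * z j μ) = Q p := by
  obtain ⟨D, s, hs, hpD, hsp, hd⟩ := hB p (h.subset hp) z hz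
  -- The solution has its graph only in `B.Y`; its domain is shrunk until the graph lies in `W`.
  have hs' := hs.mono h.isOpen
  have hpp : (p.1, s p.1) = p := by rw [hsp]
  have hmem : p.1 ∈ D ∩ (fun x => (x, s x)) ⁻¹' W := ⟨hpD, by simpa [hpp] using hp⟩
  have := h.holds _ s hs' p.1 hmem
  rw [sectionDiv_eq h.isOpen h.smooth_K hs'.1 hmem, hpp] at this
  simpa only [hd] using this

variable {B}

/-- Main fields turn a current into a supplementary balance law. -/
lemma IsMainFields.isSupplementary {W : Set (Conf n m)} (hWo : IsOpen W) (hW : W ⊆ B.Y)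
    {K : Fin (n + 1) → Conf n m → ℝ} {Q : Conf n m → ℝ} {lam : Fin m → Conf n m → ℝ}
    (hK : ∀ μ, ContDiffOn ℝ ∞ (K μ) W) (hQ : ContDiffOn ℝ ∞ Q W)
    (h : B.IsMainFields W K Q lam) : B.IsSupplementary W K Q := by
  refine ⟨hWo, hW, hK, hQ, fun D s hs x hx => ?_⟩
  have hp := hs.1.mem x hx
  have hsol := fun i => hs.2 x hx i
  simp only [sectionDiv_eq hWo (fun μ => (B.smooth_F μ _).mono hW) hs.1 hx] at hsol
  rw [sectionDiv_eq hWo hK hs.1 hx]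
  have hsrc := h.source _ hp
  simp only [← hsol, ← h.vert _ hp, Finset.sum_add_distrib] at hsrc ⊢
  rw [sum_sum_mul_mul_comm]
  simp only [add_sub_cancel_left] at hsrc
  linarith

/-- Commuting the derivatives of `h` makes the outer ones act on λⁱ = ∂h/∂yⁱ, the form in which they
occur in the closedness of ∑ λⁱ d_vF^A_i. -/
lemma defOp_eq (A : Fin n) (j k : Fin m) {W : Set (Conf n m)} (hW : IsOpen W)
    {h : Conf n m → ℝ} (hh : ContDiffOn ℝ ∞ h W) {p : Conf n m} (hp : p ∈ W) :
    B.defOp A j k h p = ∑ i, vertDeriv j (vertDeriv i h) p * vertDeriv k (B.F A.succ i) p -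
      ∑ i, vertDeriv k (vertDeriv i h) p * vertDeriv j (B.F A.succ i) p := by
  simp only [defOp, etaApply, eta]
  congr 1 <;> refine Finset.sum_congr rfl fun i _ => ?_ <;>
    rw [mul_comm, vertDeriv_comm hW hh i _ hp]

section DensitiesAreFields

variable (hF : ∀ p ∈ B.Y, ∀ i, B.F 0 i p = p.2 i)
include hF

lemma vertDeriv_density {p : Conf n m} (hp : p ∈ B.Y) (i j : Fin m) :
    vertDeriv j (B.F 0 i) p = (Pi.single j 1 : Fin m → ℝ) i := by
  rw [vertDeriv_congr B.isOpen (fun q hq => hF q hq i) j hp, vertDeriv_snd_apply]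

lemma sum_mul_vertDeriv_density {p : Conf n m} (hp : p ∈ B.Y) (j : Fin m) (a : Fin m → ℝ) :
    ∑ i, a i * vertDeriv j (B.F 0 i) p = a j := by
  simp [vertDeriv_density hF hp, Pi.single_apply]

lemma sum_vertDeriv_density_mul {p : Conf n m} (hp : p ∈ B.Y) (i : Fin m) (a : Fin m → ℝ) :
    ∑ j, vertDeriv j (B.F 0 i) p * a j = a i := by
  simp [vertDeriv_density hF hp, Pi.single_apply]

lemma baseDeriv_density {p : Conf n m} (hp : p ∈ B.Y) (i : Fin m) (μ : Fin (n + 1)) :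
    baseDeriv μ (B.F 0 i) p = 0 := by
  rw [baseDeriv_congr B.isOpen (fun q hq => hF q hq i) μ hp, baseDeriv_snd_apply]

/-- Spatial derivatives of the fields can be prescribed arbitrarily in a jet satisfying the
equations. -/
lemma exists_jetSatisfies {p : Conf n m} (hp : p ∈ B.Y) (w : Fin m → Fin n → ℝ) :
    ∃ z, B.JetSatisfies p z ∧ ∀ j A, z j (Fin.succ A) = w j A := by
  -- The time component is the i-th equation solved for ∂_t yⁱ.
  refine ⟨fun i => Fin.cons (B.Prod i p - ∑ A : Fin n, (baseDeriv A.succ (B.F A.succ i) p +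
    ∑ j, vertDeriv j (B.F A.succ i) p * w j A)) (w i), fun i => ?_, fun j A => by simp⟩
  rw [Fin.sum_univ_succ, sum_vertDeriv_density_mul hF hp i, baseDeriv_density hF hp]
  simp

lemma IsMainFields.eq_vertDeriv {W : Set (Conf n m)} (hW : W ⊆ B.Y)
    {K : Fin (n + 1) → Conf n m → ℝ} {Q : Conf n m → ℝ} {lam : Fin m → Conf n m → ℝ}
    (h : B.IsMainFields W K Q lam) (i : Fin m) {p : Conf n m} (hp : p ∈ W) :
    lam i p = vertDeriv i (K 0) p := by
  rw [← h.vert p hp 0 i, sum_mul_vertDeriv_density hF (hW hp)]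

/-- The vertical derivatives of the density of a supplementary balance law are main fields. -/
lemma IsSupplementary.isMainFields (hB : B.IsLocallySolvable) {W : Set (Conf n m)}
    {K : Fin (n + 1) → Conf n m → ℝ} {Q : Conf n m → ℝ} (h : B.IsSupplementary W K Q)
    {lam : Fin m → Conf n m → ℝ} (hlam : ∀ i, ∀ p ∈ W, lam i p = vertDeriv i (K 0) p) :
    B.IsMainFields W K Q lam := by
  -- After elimination of the time derivatives the left side is linear in `w` and the right side
  -- does not depend on it. Taking `w = 0` gives the source equation; an indicator function then
  -- isolates each flux equation.
  have key : ∀ p ∈ W, ∀ w : Fin m → Fin n → ℝ,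
      ∑ A : Fin n, ∑ j, (vertDeriv j (K A.succ) p -
        ∑ i, lam i p * vertDeriv j (B.F A.succ i) p) * w j A =
      Q p - ∑ μ, baseDeriv μ (K μ) p -
        ∑ i, lam i p * (B.Prod i p - ∑ μ, baseDeriv μ (B.F μ i) p) := by
    intro p hp w
    obtain ⟨z, hz, hzw⟩ := exists_jetSatisfies hF (h.subset hp) w
    have hjet := h.jet hB hp hz
    have h0 : ∀ i, z i 0 + ∑ A : Fin n, ∑ j, vertDeriv j (B.F A.succ i) p * w j A =
        B.Prod i p - ∑ μ, baseDeriv μ (B.F μ i) p := by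
      intro i
      have := hz i
      rw [Finset.sum_add_distrib, Fin.sum_univ_succ (fun μ => ∑ j, _ * _),
        sum_vertDeriv_density_mul hF (h.subset hp) i] at this
      simp only [hzw] at this
      linarith
    rw [Finset.sum_add_distrib, Fin.sum_univ_succ (fun μ => ∑ j, _ * _)] at hjet
    simp only [hzw] at hjet
    simp only [← h0, mul_add, Finset.sum_add_distrib, sub_mul, Finset.sum_sub_distrib]
    have e1 : ∑ i, lam i p * z i 0 = ∑ j, vertDeriv j (K 0) p * z j 0 :=
      Finset.sum_congr rfl fun i _ => by rw [hlam i p hp]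
    rw [e1, sum_sum_mul_mul_comm]
    linarith
  have source : ∀ p ∈ W, Q p - ∑ μ, baseDeriv μ (K μ) p -
      ∑ i, lam i p * (B.Prod i p - ∑ μ, baseDeriv μ (B.F μ i) p) = 0 := fun p hp => by
    rw [← key p hp 0]; simp
  refine ⟨fun i => ?_, fun p hp μ j => ?_, fun p hp => by linarith [source p hp]⟩
  · exact (contDiffOn_vertDeriv h.isOpen (h.smooth_K 0) i).congr (hlam i)
  · induction μ using Fin.cases with
    | zero => rw [sum_mul_vertDeriv_density hF (h.subset hp), hlam j p hp]
    | succ A =>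
      have := key p hp (fun j' A' => if j' = j ∧ A' = A then 1 else 0)
      rw [source p hp, Finset.sum_eq_single A, Finset.sum_eq_single j] at this
      · simp at this; linarith
      · intro j' _ hj'; simp [hj']
      · simp
      · intro A' _ hA'; simp [hA']
      · simp

end DensitiesAreFields
end BalanceSystem

/-! ### Generating densities: Hessian and defining equations. -/

lemma linearIndependent_iff_det_apply_single_ne_zero (T : Fin m → (Fin m → ℝ) →L[ℝ] ℝ) :
    LinearIndependent ℝ T ↔ (Matrix.of fun i j => T j (Pi.single i 1)).det ≠ 0 := by
  let e : ((Fin m → ℝ) →L[ℝ] ℝ) →ₗ[ℝ] (Fin m → ℝ) :=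
    { toFun := fun T j => T (Pi.single j 1)
      map_add' := fun _ _ => rfl
      map_smul' := fun _ _ => rfl }
  have he : LinearMap.ker e = ⊥ := by
    refine LinearMap.ker_eq_bot'.2 fun S hS => ?_
    refine ContinuousLinearMap.coe_injective (LinearMap.pi_ext' fun i => ?_)
    ext
    simpa [e] using congrFun hS i
  rw [← e.linearIndependent_iff he, ← Matrix.det_transpose, ← isUnit_iff_ne_zero,
    ← Matrix.isUnit_iff_isUnit_det, ← Matrix.linearIndependent_rows_iff_isUnit]
  rfl

lemma det_vertHessian_ne_zero_iff {W : Set (Conf n m)} (hW : IsOpen W) {h : Conf n m → ℝ}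
    {lam : Fin m → Conf n m → ℝ} (hlam : ∀ i, ∀ p ∈ W, lam i p = vertDeriv i h p)
    {p : Conf n m} (hp : p ∈ W) :
    (vertHessian h p).det ≠ 0 ↔ LinearIndependent ℝ fun i => vertDiff (lam i) p := by
  rw [linearIndependent_iff_det_apply_single_ne_zero]
  have : vertHessian h p = Matrix.of fun i j => vertDiff (lam j) p (Pi.single i 1) := by
    ext i j
    exact (vertDeriv_congr hW (hlam j) i hp).symm
  rw [this]

namespace BalanceSystem

variable {B : BalanceSystem n m}

/-- Equality of mixed derivatives of the fluxes of a balance law with main fields `∂h/∂yⁱ`. -/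
lemma IsMainFields.defOp_eq_zero {W : Set (Conf n m)} (hW : IsOpen W) (hWY : W ⊆ B.Y)
    {K : Fin (n + 1) → Conf n m → ℝ} {Q : Conf n m → ℝ} {lam : Fin m → Conf n m → ℝ}
    (hm : B.IsMainFields W K Q lam) (hK : ∀ μ, ContDiffOn ℝ ∞ (K μ) W) {h : Conf n m → ℝ}
    (hh : ContDiffOn ℝ ∞ h W) (hlam : ∀ i, ∀ p ∈ W, lam i p = vertDeriv i h p)
    (A : Fin n) (j k : Fin m) {p : Conf n m} (hp : p ∈ W) : B.defOp A j k h p = 0 := by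
  have hFW : ∀ i, ContDiffOn ℝ ∞ (B.F A.succ i) W := fun i => (B.smooth_F _ i).mono hWY
  have key : ∀ j k, vertDeriv k (vertDeriv j (K A.succ)) p =
      ∑ i, (lam i p * vertDeriv k (vertDeriv j (B.F A.succ i)) p +
        vertDeriv k (lam i) p * vertDeriv j (B.F A.succ i) p) := fun j k => by
    rw [← vertDeriv_sum_mul hW hm.smooth (fun i => contDiffOn_vertDeriv hW (hFW i) j) k hp]
    exact vertDeriv_congr hW (fun q hq => (hm.vert q hq A.succ j).symm) k hp
  have h1 := vertDeriv_comm hW (hK A.succ) j k hp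
  rw [key, key, Finset.sum_add_distrib, Finset.sum_add_distrib] at h1
  have h2 : ∀ i, vertDeriv k (vertDeriv j (B.F A.succ i)) p =
      vertDeriv j (vertDeriv k (B.F A.succ i)) p := fun i => vertDeriv_comm hW (hFW i) k j hp
  -- The terms with second derivatives of the fluxes are symmetric in j, k and cancel.
  simp only [h2, add_right_inj] at h1
  rw [defOp_eq A j k hW hh hp, sub_eq_zero]
  simpa only [vertDeriv_congr hW (hlam _) _ hp] using h1

/-- On a product of a base neighbourhood and a ball of the fibre, a solution `h` of the defining
equations is the density of a balance law with main fields `∂h/∂yⁱ`. -/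
lemma exists_isMainFields (hF : ∀ p ∈ B.Y, ∀ i, B.F 0 i p = p.2 i)
    {U : Set (Fin (n + 1) → ℝ)} (hU : IsOpen U) {y₀ : Fin m → ℝ} {r : ℝ} (hr : 0 < r)
    (hY : U ×ˢ Metric.ball y₀ r ⊆ B.Y) {h : Conf n m → ℝ}
    (hh : ContDiffOn ℝ ∞ h (U ×ˢ Metric.ball y₀ r))
    (hdef : ∀ p ∈ U ×ˢ Metric.ball y₀ r, ∀ A j k, k ≠ j → B.defOp A j k h p = 0) :
    ∃ (K : Fin (n + 1) → Conf n m → ℝ) (Q : Conf n m → ℝ), K 0 = h ∧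
      (∀ μ, ContDiffOn ℝ ∞ (K μ) (U ×ˢ Metric.ball y₀ r)) ∧
      ContDiffOn ℝ ∞ Q (U ×ˢ Metric.ball y₀ r) ∧
      B.IsMainFields (U ×ˢ Metric.ball y₀ r) K Q fun i => vertDeriv i h := by
  have hW : IsOpen (U ×ˢ Metric.ball y₀ r) := hU.prod Metric.isOpen_ball
  have hFW : ∀ μ i, ContDiffOn ℝ ∞ (B.F μ i) (U ×ˢ Metric.ball y₀ r) :=
    fun μ i => (B.smooth_F μ i).mono hY
  have hlam : ∀ i, ContDiffOn ℝ ∞ (vertDeriv i h) (U ×ˢ Metric.ball y₀ r) :=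
    fun i => contDiffOn_vertDeriv hW hh i
  have hflux : ∀ A : Fin n, ∃ K : Conf n m → ℝ, ContDiffOn ℝ ∞ K (U ×ˢ Metric.ball y₀ r) ∧
      ∀ p ∈ U ×ˢ Metric.ball y₀ r, ∀ j,
        vertDeriv j K p = ∑ i, vertDeriv i h p * vertDeriv j (B.F A.succ i) p := by
    intro A
    refine exists_vertDeriv_eq hU hr (g := fun j p => ∑ i, vertDeriv i h p *
      vertDeriv j (B.F A.succ i) p) (fun j => ContDiffOn.sum fun i _ => (hlam i).mul
        (contDiffOn_vertDeriv hW (hFW _ i) j)) fun p hp j k => ?_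
    rcases eq_or_ne k j with rfl | hkj
    · rfl
    have h0 := hdef p hp A j k hkj
    rw [defOp_eq A j k hW hh hp, sub_eq_zero] at h0
    rw [vertDeriv_sum_mul hW hlam (fun i => contDiffOn_vertDeriv hW (hFW _ i) j) k hp,
      vertDeriv_sum_mul hW hlam (fun i => contDiffOn_vertDeriv hW (hFW _ i) k) j hp,
      Finset.sum_add_distrib, Finset.sum_add_distrib, h0]
    simp only [vertDeriv_comm hW (hFW A.succ _) k j hp]
  choose κ hκ hκ' using hflux
  let K : Fin (n + 1) → Conf n m → ℝ := Fin.cons h κ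
  have hK : ∀ μ, ContDiffOn ℝ ∞ (K μ) (U ×ˢ Metric.ball y₀ r) :=
    Fin.cases (by simpa [K] using hh) (by simpa [K] using hκ)
  -- `Q` is read off from the source equation, which therefore holds trivially.
  refine ⟨K, fun p => ∑ i, vertDeriv i h p * (B.Prod i p - ∑ μ, baseDeriv μ (B.F μ i) p) +
    ∑ μ, baseDeriv μ (K μ) p, rfl, hK, ?_, hlam, fun p hp μ j => ?_, fun p _ => by simp⟩
  · exact (ContDiffOn.sum fun i _ => (hlam i).mul (((B.smooth_Prod i).mono hY).sub
      (ContDiffOn.sum fun μ _ => contDiffOn_baseDeriv hW (hFW μ i) μ))).add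
      (ContDiffOn.sum fun μ _ => contDiffOn_baseDeriv hW (hK μ) μ)
  · induction μ using Fin.cases with
    | zero => exact sum_mul_vertDeriv_density hF (hY hp) j fun i => vertDeriv i h p
    | succ A => exact (hκ' A p hp j).symm

lemma generatesSupplementaryNear_iff (hF : ∀ p ∈ B.Y, ∀ i, B.F 0 i p = p.2 i)
    {V : Set (Conf n m)} {p₀ : Conf n m} {h : Conf n m → ℝ} (hV : IsOpen V) (hVY : V ⊆ B.Y)
    (hp₀ : p₀ ∈ V) (hh : ContDiffOn ℝ ∞ h V) :
    B.GeneratesSupplementaryNear p₀ h ↔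
      ∀ᶠ p in nhds p₀, (∀ A j k, k ≠ j → B.defOp A j k h p = 0) ∧
        (vertHessian h p).det ≠ 0 := by
  constructor
  · rintro ⟨W, K, Q, lam, hpW, hK, hK0, hlam, hind⟩
    have hhW : ContDiffOn ℝ ∞ h W := (hK.smooth_K 0).congr fun p hp => (hK0 p hp).symm
    have hlam' : ∀ i, ∀ p ∈ W, lam i p = vertDeriv i h p := fun i p hp => by
      rw [hlam.eq_vertDeriv hF hK.subset i hp, vertDeriv_congr hK.isOpen hK0 i hp]
    filter_upwards [hK.isOpen.mem_nhds hpW] with p hp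
    exact ⟨fun A j k _ => hlam.defOp_eq_zero hK.isOpen hK.subset hK.smooth_K hhW hlam' A j k hp,
      (det_vertHessian_ne_zero_iff hK.isOpen hlam' hp).2 (hind p hp)⟩
  · intro hev
    obtain ⟨r, hr, hball⟩ := Metric.nhds_basis_ball.mem_iff.1
      (Filter.inter_mem (hV.mem_nhds hp₀) hev)
    -- In the sup metric a ball is a product of balls, the shape required by the fibrewise Poincaré
    -- lemma.
    rw [← ball_prod_same] at hball
    have hBV := hball.trans Set.inter_subset_left
    have hW : IsOpen (Metric.ball p₀.1 r ×ˢ Metric.ball p₀.2 r) :=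
      Metric.isOpen_ball.prod Metric.isOpen_ball
    obtain ⟨K, Q, hK0, hK, hQ, hlam⟩ := exists_isMainFields hF Metric.isOpen_ball hr
      (hBV.trans hVY) (hh.mono hBV) fun p hp => (hball hp).2.1
    refine ⟨Metric.ball p₀.1 r ×ˢ Metric.ball p₀.2 r, K, Q, _,
      ⟨Metric.mem_ball_self hr, Metric.mem_ball_self hr⟩,
      hlam.isSupplementary hW (hBV.trans hVY) hK hQ, fun p _ => by rw [hK0], hlam, fun p hp => ?_⟩
    exact (det_vertHessian_ne_zero_iff hW (fun _ _ _ => rfl) hp).1 (hball hp).2.2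

/-! ### The characteristic variety. -/

lemma evalAt_opSymbol (A : Fin n) (j k : Fin m) (p : B.Y) (ζ : Fin m → ℝ) :
    B.evalAt p ζ (B.opSymbol A j k) =
      B.covectorOp A p ζ k * ζ j - B.covectorOp A p ζ j * ζ k := by
  simp [evalAt, opSymbol, etaSymbol, etaCoeff, eta, covectorOp, Matrix.mulVec, dotProduct]

/-- The annihilator of the cyclic module E[ζ]/I is I, so its support consists of the primes
containing I; the prime of a covector is the kernel of evaluation there. -/
lemma mem_charVariety_iff (q : B.Y × (Fin m → ℝ)) :
    q ∈ B.charVariety ↔ ∀ A j k, j ≠ k → B.evalAt q.1 q.2 (B.opSymbol A j k) = 0 := by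
  rw [charVariety, Set.mem_ofPred_eq, Module.support_eq_zeroLocus, Ideal.annihilator_quotient,
    PrimeSpectrum.mem_zeroLocus, SetLike.coe_subset_coe]
  change B.symbolIdeal ≤ RingHom.ker (B.evalAt q.1 q.2) ↔ _
  rw [symbolIdeal, Ideal.span_le]
  constructor
  · exact fun hq A j k hjk => hq ⟨A, j, k, hjk, rfl⟩
  · rintro hq _ ⟨A, j, k, hjk, rfl⟩
    exact hq A j k hjk

/-- Two vectors with vanishing `2 × 2` minors, the second being nonzero, are proportional. -/
lemma _root_.exists_eq_smul_of_mul_eq_mul {v w : Fin m → ℝ} (hv : v ≠ 0)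
    (h : ∀ j k, j ≠ k → w k * v j = w j * v k) : ∃ c : ℝ, w = c • v := by
  obtain ⟨i, hi⟩ := Function.ne_iff.1 hv
  have hi : v i ≠ 0 := hi
  refine ⟨w i / v i, funext fun k => ?_⟩
  rcases eq_or_ne i k with rfl | hik
  · simp [hi]
  · simp only [Pi.smul_apply, smul_eq_mul]
    field_simp
    linarith [h i k hik]

/-- The characteristic variety is the union of the zero section and of the lines spanned by the
common eigenvectors. -/
lemma charVariety_eq :
    B.charVariety = {q | q.2 = 0} ∪
      {q | ∃ v, B.IsCommonEigenvector q.1 v ∧ ∃ c : ℝ, q.2 = c • v} := by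
  ext ⟨p, ζ⟩
  simp only [mem_charVariety_iff, evalAt_opSymbol, sub_eq_zero, Set.mem_union, Set.mem_ofPred_eq]
  constructor
  · intro hq
    by_cases hζ : ζ = 0
    · exact Or.inl hζ
    -- A nonzero ζ in the variety is itself the common eigenvector.
    · refine Or.inr ⟨ζ, ⟨hζ, fun A => ?_⟩, 1, (one_smul ℝ ζ).symm⟩
      obtain ⟨c, hc⟩ := exists_eq_smul_of_mul_eq_mul hζ (hq A)
      exact ⟨c, Module.End.mem_eigenspace_iff.2 hc, hζ⟩
  · rintro (rfl | ⟨v, ⟨-, hv⟩, c, rfl⟩) A j k -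
    · simp
    · obtain ⟨μ, hμ⟩ := hv A
      simp only [map_smul, hμ.apply_eq_smul, Pi.smul_apply, smul_eq_mul]
      ring

end BalanceSystem

end

theorem theorem5 {n m : ℕ} (B : BalanceSystem n m)
    (hF : ∀ p ∈ B.Y, ∀ i, B.F 0 i p = p.2 i) :
    (B.IsLocallySolvable →
      (∀ (W : Set (Conf n m)) (K : Fin (n + 1) → Conf n m → ℝ) (Q : Conf n m → ℝ),
        B.IsSupplementary W K Q → ∀ lam : Fin m → Conf n m → ℝ,
          (B.IsMainFields W K Q lam ↔ ∀ i, ∀ p ∈ W, lam i p = vertDeriv i (K 0) p)) ∧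
      (∀ (V : Set (Conf n m)) (p₀ : Conf n m) (h : Conf n m → ℝ),
        IsOpen V → V ⊆ B.Y → p₀ ∈ V → ContDiffOn ℝ ∞ h V →
          (B.GeneratesSupplementaryNear p₀ h ↔
            ∀ᶠ p in nhds p₀, (∀ A j k, k ≠ j → B.defOp A j k h p = 0) ∧
              (vertHessian h p).det ≠ 0))) ∧
    B.charVariety =
      {q | q.2 = 0} ∪
        {q | ∃ v, B.IsCommonEigenvector q.1 v ∧ ∃ c : ℝ, q.2 = c • v} := by
  refine ⟨fun hB => ⟨fun W K Q hK lam => ⟨fun h i p hp => h.eq_vertDeriv hF hK.subset i hp,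
    hK.isMainFields hF hB⟩, fun V p₀ h hV hVY hp₀ hh =>
      BalanceSystem.generatesSupplementaryNear_iff hF hV hVY hp₀ hh⟩,
    BalanceSystem.charVariety_eq⟩
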